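/- All graphs are finite, simple and undirected. For a connected graph $G$ with vertices $v_1,\dots,v_n$, let $\mu(G)$ denote its distance spectral radius, i.e. the largest eigenvalue of the $n\times n$ matrix whose $(i,j)$-entry is the distance between $v_i$ and $v_j$ in $G$, and let $\delta(G)$ denote its minimum degree. The leaf distance of a tree is the minimum distance between any two distinct leaves (vertices of degree one) of the tree. Let $K_m$ be the complete graph on $m$ vertices, $tK_1$ the graph with $t$ vertices and no edges, $\cup$ the disjoint union and $\vee$ the join of graphs (the disjoint union together with all edges between the two vertex sets). **Theorem.** Let $t\ge 1$ be an integer and let $G$ be a connected graph of order $n\ge 7t+2$ with $\delta(G)\ge t$. If $$\mu(G)\le \mu\bigl(K_t\vee(K_{n-2t}\cup tK_1)\bigr),$$ then $G$ has a spanning tree with leaf distance at least four. -/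

import Mathlib

namespace SimpleGraph

/-- The join of two vertex-disjoint graphs: their disjoint union together with every edge between
the two vertex sets. -/
def join {V W : Type*} (G : SimpleGraph V) (H : SimpleGraph W) : SimpleGraph (V ⊕ W) :=
  (G ⊕g H) ⊔ completeBipartiteGraph V W

/-- The distance matrix of a graph, with real entries. -/
noncomputable def distMatrix {V : Type*} (G : SimpleGraph V) : Matrix V V ℝ :=
  Matrix.of fun u v => (G.dist u v : ℝ)

/-- The distance spectral radius: the largest real eigenvalue of the distance matrix. -/
noncomputable def distSpectralRadius {V : Type*} [Fintype V] (G : SimpleGraph V) : ℝ :=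
  sSup {x : ℝ | Module.End.HasEigenvalue G.distMatrix.mulVecLin x}

/-- On a nonempty finite vertex set the supremum in `distSpectralRadius` is a maximum. -/
theorem isGreatest_distSpectralRadius {V : Type*} [Fintype V] [Nonempty V] (G : SimpleGraph V) :
    IsGreatest {x : ℝ | Module.End.HasEigenvalue G.distMatrix.mulVecLin x}
      G.distSpectralRadius := by
  classical
  have hA : G.distMatrix.IsHermitian := by
    ext u v
    simp [distMatrix, SimpleGraph.dist_comm]
  have hS : {x : ℝ | Module.End.HasEigenvalue G.distMatrix.mulVecLin x}
      = Set.range hA.eigenvalues := by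
    rw [← hA.spectrum_real_eq_range_eigenvalues, ← Matrix.spectrum_toLin']
    ext x
    rw [Set.mem_ofPred_eq, Module.End.hasEigenvalue_iff_mem_spectrum, Matrix.toLin'_apply']
  have hmem := (Set.range_nonempty hA.eigenvalues).csSup_mem (Set.finite_range _)
  rw [distSpectralRadius, hS]
  exact ⟨hmem, fun x hx => le_csSup (Set.finite_range _).bddAbove hx⟩

/-- The graph `K_t ∨ (K_{n-2t} ∪ t K_1)`, intended for `2 * t ≤ n`. -/
def extremalGraph (n t : ℕ) : SimpleGraph (Fin t ⊕ (Fin (n - 2 * t) ⊕ Fin t)) :=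
  join (completeGraph (Fin t)) (completeGraph (Fin (n - 2 * t)) ⊕g emptyGraph (Fin t))

/-- A leaf is a vertex of degree one. -/
def IsLeaf {V : Type*} (T : SimpleGraph V) (v : V) : Prop :=
  (T.neighborSet v).ncard = 1

/-- The leaf distance of a tree: the minimum distance between two distinct leaves
(every finite tree with at least two vertices has two leaves, so `⊤` only occurs for a
single vertex). -/
noncomputable def leafDistance {V : Type*} (T : SimpleGraph V) : ℕ∞ :=
  ⨅ (u : V) (v : V) (_ : T.IsLeaf u) (_ : T.IsLeaf v) (_ : u ≠ v), T.edist u v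

end SimpleGraph

/-!
The graph `G` even has a Hamiltonian path, and a path on at least five vertices is a tree whose two
leaves are at distance at least four.

Suppose that `G` has no Hamiltonian path, and add edges to get a maximal graph `H` without one. By
the rotation argument of Ore and Bondy–Chvátal, nonadjacent vertices of `H` have degree sum at most
`n - 2` (`degree_add_degree_le`). Two consequences are used. Among the nonneighbours of a suitable
vertex there is a set `A` of `k` vertices of degree less than `k`, with `t + 1 ≤ k ≤ n / 2`
(`exists_low_degree_set`, as in Chvátal's theorem on degree sequences); and a vertex of `H` is
either adjacent to all others or has at least `t + 1` nonneighbours.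

The distance matrix of `K_t ∨ (K_{n-2t} ∪ t K_1)` has a positive eigenvector with values `a`, `1`
and `c` on the three blocks, for an eigenvalue `m - 1` (`exists_weights`), so `m - 1` bounds its
distance spectral radius (`distSpectralRadius_extremalGraph_le`). The vector on `G` with value `c`
on `A`, value `a` on at most `t` vertices that are dominating in `H`, and `1` elsewhere has a
Rayleigh quotient larger than `m - 1`. Only two facts about distances in `G` enter: they are at
least one, and at least two for pairs nonadjacent in `H`; the pairs nonadjacent in `H` are counted
through degrees (`lt_distSpectralRadius`). The resulting inequality between real numbers is
`rayleigh_inequality`; there `k ≥ t + 1`, against the `t` low vertices of the extremal graph,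
provides the gain, and `n ≥ 7 t + 2` makes it outweigh the losses.
-/

namespace SimpleGraph

open Finset

/-! ### Bounds for the distance spectral radius -/

/-- The Rayleigh quotient of the distance matrix is at most the distance spectral radius. -/
theorem sum_mul_dist_le {V : Type*} [Fintype V] [Nonempty V] (G : SimpleGraph V) (x : V → ℝ) :
    ∑ u, ∑ v, x u * (G.dist u v * x v) ≤ G.distSpectralRadius * ∑ v, x v ^ 2 := by
  classical
  have hA : G.distMatrix.IsHermitian := by
    ext u v
    simp [distMatrix, SimpleGraph.dist_comm]
  have hev := (isGreatest_distSpectralRadius G).2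
  set ρ := G.distSpectralRadius
  have hB : (ρ • (1 : Matrix V V ℝ) - G.distMatrix).PosSemidef := by
    have hH : (ρ • (1 : Matrix V V ℝ) - G.distMatrix).IsHermitian := by
      refine Matrix.IsHermitian.sub ?_ hA
      ext; simp [Matrix.one_apply, eq_comm]
    rw [Matrix.posSemidef_iff_isHermitian_and_spectrum_nonneg]
    refine ⟨hH, fun s hs => ?_⟩
    rw [← Matrix.spectrum_toLin', ← Module.End.hasEigenvalue_iff_mem_spectrum] at hs
    obtain ⟨w, hw⟩ := hs.exists_hasEigenvector
    have h1 := hw.apply_eq_smul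
    have : Module.End.HasEigenvalue G.distMatrix.mulVecLin (ρ - s) := by
      refine Module.End.hasEigenvalue_of_hasEigenvector (x := w) ?_
      rw [Module.End.hasEigenvector_iff, Module.End.mem_eigenspace_iff]
      refine ⟨?_, hw.2⟩
      rw [Matrix.toLin'_apply, Matrix.sub_mulVec, Matrix.smul_mulVec, Matrix.one_mulVec] at h1
      rw [Matrix.mulVecLin_apply, sub_smul, ← h1]; simp
    have := hev this
    show 0 ≤ s
    linarith
  have h := hB.dotProduct_mulVec_nonneg x
  rw [Matrix.sub_mulVec, Matrix.smul_mulVec, Matrix.one_mulVec, dotProduct_sub] at h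
  simp only [dotProduct, Matrix.mulVec, star_trivial, distMatrix, Matrix.of_apply,
    Pi.smul_apply, smul_eq_mul, Finset.mul_sum] at h ⊢
  have e : ∑ v, x v * (ρ * x v) = ∑ v, ρ * x v ^ 2 := Finset.sum_congr rfl fun v _ => by ring
  linarith

/-- A positive vector `x` with `D x ≤ r x` bounds the distance spectral radius by `r`: compare an
eigenvector `w` with `x` at a vertex where `|w| / x` is largest. -/
theorem distSpectralRadius_le {V : Type*} [Fintype V] [Nonempty V] (G : SimpleGraph V) (x : V → ℝ)
    (hx : ∀ v, 0 < x v) (r : ℝ) (h : ∀ u, ∑ v, G.dist u v * x v ≤ r * x u) :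
    G.distSpectralRadius ≤ r := by
  obtain ⟨w, hw⟩ := (isGreatest_distSpectralRadius G).1.exists_hasEigenvector
  have h1 := hw.apply_eq_smul
  have hne := hw.2
  set ρ := G.distSpectralRadius
  obtain ⟨i, hi⟩ := Finite.exists_max fun v => |w v| / x v
  have hpos : 0 < |w i| := by
    by_contra h0
    refine hne (funext fun v => ?_)
    have := hi v
    rw [abs_nonpos_iff.1 (not_lt.1 h0), abs_zero, zero_div, div_nonpos_iff] at this
    have := hx v
    have := abs_nonneg (w v)
    simp only [Pi.zero_apply]
    rw [← abs_nonpos_iff]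
    grind
  have h2 := congrFun h1 i
  simp only [Matrix.mulVecLin_apply, Matrix.mulVec, dotProduct, distMatrix, Matrix.of_apply,
    Pi.smul_apply, smul_eq_mul] at h2
  have h3 : ρ * |w i| ≤ r * |w i| := calc
    ρ * |w i| ≤ |ρ * w i| := by rw [abs_mul]; gcongr; exact le_abs_self _
    _ ≤ ∑ v, |(G.dist i v : ℝ) * w v| := by rw [← h2]; exact abs_sum_le_sum_abs _ _
    _ ≤ ∑ v, (G.dist i v * x v) * (|w i| / x i) := by
        refine sum_le_sum fun v _ => ?_
        rw [abs_mul, Nat.abs_cast, mul_assoc]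
        gcongr
        rw [mul_comm, ← div_le_iff₀ (hx v)]
        exact hi v
    _ ≤ (r * x i) * (|w i| / x i) := by
        rw [← sum_mul]
        exact mul_le_mul_of_nonneg_right (h i) (div_nonneg (abs_nonneg _) (hx i).le)
    _ = r * |w i| := by have := hx i; field_simp
  exact le_of_mul_le_mul_right h3 hpos

/-- For `G ≤ H` the distance matrix of `G` dominates `J - I` plus the adjacency matrix of `Hᶜ`. This
is the comparison of the quadratic forms at a nonnegative vector. -/
theorem Connected.le_sum_mul_dist {V : Type*} [Fintype V] [DecidableEq V] {G H : SimpleGraph V}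
    [DecidableRel H.Adj] (hG : G.Connected) (hGH : G ≤ H) {x : V → ℝ} (hx : ∀ v, 0 ≤ x v) :
    (∑ v, x v) ^ 2 - ∑ v, x v ^ 2 + ∑ u, ∑ v, x u * x v * Hᶜ.adjMatrix ℝ u v ≤
      ∑ u, ∑ v, x u * (G.dist u v * x v) := by
  have h : (∑ v, x v) ^ 2 - ∑ v, x v ^ 2 + ∑ u, ∑ v, x u * x v * Hᶜ.adjMatrix ℝ u v =
      ∑ u, ∑ v, x u * ((((if u = v then 0 else 1) + Hᶜ.adjMatrix ℝ u v)) * x v) := by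
    have h1 : ∀ u v, x u * ((((if u = v then 0 else 1) + Hᶜ.adjMatrix ℝ u v)) * x v) =
        x u * x v - (if u = v then x u ^ 2 else 0) + x u * x v * Hᶜ.adjMatrix ℝ u v := by
      intro u v
      split_ifs with h
      · subst h; ring
      · ring
    simp_rw [h1, sum_add_distrib, sum_sub_distrib, sum_ite_eq, if_pos (mem_univ _),
      sq (∑ v, x v), sum_mul_sum]
  rw [h]
  refine sum_le_sum fun u _ => sum_le_sum fun v _ => mul_le_mul_of_nonneg_left
    (mul_le_mul_of_nonneg_right ?_ (hx v)) (hx u)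
  simp only [adjMatrix_apply, compl_adj]
  by_cases huv : u = v
  · simp [huv]
  by_cases hadj : H.Adj u v
  · have := hG.pos_dist_of_ne huv
    rw [if_neg huv, if_neg fun h => h.2 hadj, add_zero]
    exact_mod_cast this
  · have := hG.one_lt_dist_of_ne_of_not_adj huv fun h => hadj (hGH h)
    rw [if_neg huv, if_pos ⟨huv, hadj⟩, one_add_one_eq_two]
    exact_mod_cast this

/-! ### The extremal graph -/

/-- The eigenvector `(a, 1, c)` of the distance matrix of `K_t ∨ (K_{n-2t} ∪ t K_1)` on its three
blocks, with eigenvalue `m - 1`: the last three equations are the eigenvalue equations, in which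
`a * m` is the sum of all entries of the vector. -/
theorem exists_weights (n t : ℝ) (ht : 1 ≤ t) (hn : 7*t+2 ≤ n) :
    ∃ m a c : ℝ, n ≤ m ∧ 1 ≤ c ∧ 0 < a ∧ a ≤ 1 ∧ c ≤ 1 + a ∧ c*(1-a) ≤ 1 ∧
      c*(m+1) = m + (n-2*t) ∧ a*m = m - t*c ∧ t*a + (n-2*t)+t*c = a*m := by
  -- Eliminating `a` and `c` leaves one equation in `m`, solved by the intermediate value theorem
  -- on `[n, n + 3 t]`.
  let c : ℝ → ℝ := fun m => (m+(n-2*t))/(m+1)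
  have hcont : ContinuousOn (fun m => m - 2*t*c m - (n-2*t) - t + t^2*c m/m) (Set.Icc n (n+3*t)) := by
    have h1 : ∀ m ∈ Set.Icc n (n+3*t), m + 1 ≠ 0 := fun m hm => by have := hm.1; linarith
    have h2 : ∀ m ∈ Set.Icc n (n+3*t), m ≠ 0 := fun m hm => by have := hm.1; linarith
    fun_prop (disch := assumption)
  have hc1 : ∀ m, n ≤ m → 1 ≤ c m := fun m hm => by
    rw [le_div_iff₀ (by linarith)]; linarith
  have hc2 : ∀ m, n ≤ m → c m ≤ 2 := fun m hm => by
    rw [div_le_iff₀ (by linarith)]; linarith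
  have hlow : n - 2*t*c n - (n-2*t) - t + t^2*c n/n ≤ 0 := by
    have h1 := hc1 n le_rfl
    have : t^2*c n/n ≤ t*c n := by
      rw [div_le_iff₀ (by linarith)]
      have := mul_le_mul_of_nonneg_left (by linarith : t ≤ n)
        (mul_nonneg (by linarith : 0 ≤ t) (by linarith : 0 ≤ c n))
      linarith
    have := mul_le_mul_of_nonneg_left h1 (by linarith : 0 ≤ t)
    linarith
  have hhigh : 0 ≤ (n+3*t) - 2*t*c (n+3*t) - (n-2*t) - t + t^2*c (n+3*t)/(n+3*t) := by
    have h1 := hc1 (n+3*t) (by linarith)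
    have h2 := hc2 (n+3*t) (by linarith)
    have : 0 ≤ t^2*c (n+3*t)/(n+3*t) :=
      div_nonneg (mul_nonneg (sq_nonneg t) (by linarith)) (by linarith)
    have := mul_le_mul_of_nonneg_left h2 (by linarith : 0 ≤ t)
    linarith
  obtain ⟨m, hm, hz⟩ := intermediate_value_Icc (by linarith : n ≤ n+3*t) hcont ⟨hlow, hhigh⟩
  have hnm := hm.1
  have hm0 : 0 < m := by linarith
  have h1 := hc1 m hnm
  have h2 := hc2 m hnm
  have htc : t*c m ≤ 2*t := by nlinarith
  have hcm : c m * (m+1) = m + (n-2*t) := div_mul_cancel₀ _ (by linarith)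
  have hz' : m - 2*t*c m - (n-2*t) - t + t*(t*c m/m) = 0 := by
    rw [← hz]; ring
  have hsmall : t*c m/m * 2 ≤ 1 := by
    rw [div_mul_eq_mul_div, div_le_one hm0]; linarith
  have h0 : 0 ≤ t*c m/m := by positivity
  have hdm : t*c m/m*m = t*c m := div_mul_cancel₀ _ hm0.ne'
  refine ⟨m, 1 - t*c m/m, c m, hnm, h1, by linarith, by linarith, ?_, ?_, hcm, ?_, ?_⟩
  · have : c m * m ≤ (1 + (1 - t*c m/m)) * m := by linarith
    exact le_of_mul_le_mul_right this hm0
  · nlinarith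
  · linarith
  · linarith

theorem distSpectralRadius_extremalGraph_le {n t : ℕ} (ht : 1 ≤ t) (hn : 2 * t ≤ n) {m a c : ℝ}
    (ha : 0 < a) (hc : 0 < c) (h1 : c * (m+1) = m + (n-2*t)) (h2 : a*m = m - t*c)
    (h3 : t*a + (n-2*t)+t*c = a*m) :
    (extremalGraph n t).distSpectralRadius ≤ m - 1 := by
  have : Nonempty (Fin t) := ⟨⟨0, ht⟩⟩
  let z : Fin t := ⟨0, ht⟩
  let w : Fin t ⊕ (Fin (n - 2 * t) ⊕ Fin t) → ℝ := Sum.elim (fun _ => a) (Sum.elim (fun _ => 1) fun _ => c)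
  have hdist1 : ∀ u v, (extremalGraph n t).Adj u v → ((extremalGraph n t).dist u v : ℝ) ≤ 1 := by
    intro u v h
    rw [dist_eq_one_iff_adj.2 h]; simp
  have hdist2 : ∀ u v : Fin (n - 2 * t) ⊕ Fin t, ((extremalGraph n t).dist (.inr u) (.inr v) : ℝ) ≤ 2 := by
    intro u v
    have a1 : (extremalGraph n t).Adj (.inr u) (.inl z) := by simp [extremalGraph, join]
    have a2 : (extremalGraph n t).Adj (.inl z) (.inr v) := by simp [extremalGraph, join]
    have := dist_le (a1.toWalk.append a2.toWalk)
    simp at this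
    exact_mod_cast this
  -- The distance matrix off its diagonal, by blocks.
  let B : Fin t ⊕ (Fin (n - 2 * t) ⊕ Fin t) → Fin t ⊕ (Fin (n - 2 * t) ⊕ Fin t) → ℝ :=
    Sum.elim (fun _ _ => 1) (Sum.elim (fun _ => Sum.elim (fun _ => 1) (Sum.elim (fun _ => 1) fun _ => 2))
      fun _ => Sum.elim (fun _ => 1) fun _ => 2)
  have hw : ∀ v, 0 < w v := by rintro (v | v | v) <;> simp [w, ha, hc]
  have hB : ∀ u v, u ≠ v → ((extremalGraph n t).dist u v : ℝ) ≤ B u v := by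
    rintro (u | u | u) (v | v | v) huv
    case inr.inl.inr.inr => exact hdist2 _ _
    case inr.inr.inr.inr => exact hdist2 _ _
    case inr.inr.inr.inl => exact hdist2 _ _
    all_goals
      refine hdist1 _ _ ?_
      revert huv
      simp [extremalGraph, join]
  have hB' : ∀ u v, (extremalGraph n t).dist u v * w v ≤
      B u v * w v - if u = v then B u u * w u else 0 := by
    intro u v
    split_ifs with h
    · simp [h]
    · rw [sub_zero]
      exact mul_le_mul_of_nonneg_right (hB u v h) (hw v).le
  refine distSpectralRadius_le _ w hw _ fun u => (sum_le_sum fun v _ => hB' u v).trans ?_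
  have hnat : ((n - 2 * t : ℕ) : ℝ) = n - 2 * t := by push_cast [hn]; ring
  rw [sum_sub_distrib, Finset.sum_ite_eq, if_pos (mem_univ u)]
  rcases u with u | u | u <;> simp [w, B, hnat, Fintype.sum_sum_type] <;> linarith
/-! ### Hamiltonian paths and degree sums -/

section

/-- A Hamiltonian path, encoded as the list of its vertices. -/
def IsHamPath {V : Type*} (G : SimpleGraph V) (l : List V) : Prop :=
  l.Nodup ∧ (∀ v, v ∈ l) ∧ l.IsChain G.Adj

/-- The graph has a Hamiltonian path. -/
def Traceable {V : Type*} (G : SimpleGraph V) : Prop := ∃ l, G.IsHamPath l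

variable {V : Type*} {G : SimpleGraph V} {u v : V}

theorem isChain_reverse_adj {l : List V} : l.reverse.IsChain G.Adj ↔ l.IsChain G.Adj := by
  rw [List.isChain_reverse]; simp only [G.adj_comm]

theorem append_cons_cancel {x : V} {a₁ a₂ b₁ b₂ : List V} (hn : (a₁ ++ x :: a₂).Nodup)
    (h : a₁ ++ x :: a₂ = b₁ ++ x :: b₂) : a₁ = b₁ ∧ a₂ = b₂ := by
  induction a₁ generalizing b₁ with
  | nil => cases b₁ <;> grind
  | cons y a₁ ih => cases b₁ <;> grind

theorem IsHamPath.of_perm {l l' : List V} (hl : l.Nodup) (hall : ∀ w, w ∈ l) (hp : l'.Perm l)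
    (hc : l'.IsChain G.Adj) : G.IsHamPath l' :=
  ⟨hp.nodup_iff.2 hl, fun w => hp.mem_iff.2 (hall w), hc⟩

/-- If a nonrepeating walk in `G + uv` is not a walk in `G`, it uses the edge `uv` exactly once. -/
theorem exists_split {l : List V} (hnd : l.Nodup) (hc : l.IsChain (G ⊔ edge u v).Adj)
    (hG : ¬ l.IsChain G.Adj) :
    ∃ a b p s, ((a = u ∧ b = v) ∨ (a = v ∧ b = u)) ∧ l = p ++ a :: b :: s ∧
      (p ++ [a]).IsChain G.Adj ∧ (b :: s).IsChain G.Adj := by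
  have hG' := hG
  rw [List.isChain_iff_forall_rel_of_append_cons_cons] at hG'
  push Not at hG'
  obtain ⟨a, b, p, s, rfl, hab⟩ := hG'
  have hedge : (a = u ∧ b = v) ∨ (a = v ∧ b = u) := by
    have := (List.isChain_iff_forall_rel_of_append_cons_cons.1 hc) rfl
    rw [sup_adj, edge_adj] at this
    tauto
  have hc1 : (p ++ [a]).IsChain (G ⊔ edge u v).Adj := hc.prefix ⟨b :: s, by simp⟩
  have hc2 : (b :: s).IsChain (G ⊔ edge u v).Adj := hc.suffix ⟨p ++ [a], by simp⟩
  have hb : b ∉ p ++ [a] := by grind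
  have ha : a ∉ b :: s := by grind
  refine ⟨a, b, p, s, hedge, rfl, List.IsChain.imp_of_mem_imp ?_ hc1, List.IsChain.imp_of_mem_imp ?_ hc2⟩
  · intro x y hx hy hxy
    rw [sup_adj, edge_adj] at hxy
    grind
  · intro x y hx hy hxy
    rw [sup_adj, edge_adj] at hxy
    grind

/-- The rotation step: let a list of all vertices consist of two paths of `G`, one ending in `u` and
one starting in `v`. If `G` has no Hamiltonian path, a neighbour of `u` is followed in the list by a
nonneighbour of `v`. -/
theorem exists_next_not_adj {p s : List V} (hG : ¬ G.Traceable) (hnd : (p ++ u :: v :: s).Nodup)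
    (hall : ∀ w, w ∈ p ++ u :: v :: s) (h1 : (p ++ [u]).IsChain G.Adj) (h2 : (v :: s).IsChain G.Adj)
    {p₁ w p₂} (hw : p ++ u :: v :: s = p₁ ++ w :: p₂) (huw : G.Adj u w) :
    ∃ y r, p₂ = y :: r ∧ ¬ G.Adj v y := by
  have key : ∀ l' : List V, l'.Perm (p ++ u :: v :: s) → ¬ l'.IsChain G.Adj := fun l' hp hc =>
    hG ⟨l', .of_perm hnd hall hp hc⟩
  have huv : ¬ G.Adj u v := fun h => key _ .rfl <| by
    have := h1.append h2 (by simpa using h)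
    simpa using this
  have hmem : w ∈ p ∨ w ∈ s := by
    have := hall w
    have := huw.ne
    grind
  rcases hmem with hmem | hmem
  · obtain ⟨q₁, q₂, rfl⟩ := List.append_of_mem hmem
    obtain ⟨y, r, hyr⟩ : ∃ y r, q₂ ++ [u] = y :: r := List.exists_cons_of_ne_nil (by simp)
    have : q₁ = p₁ ∧ q₂ ++ [u] ++ v :: s = p₂ := by
      have hE : q₁ ++ w :: (q₂ ++ [u] ++ v :: s) = p₁ ++ w :: p₂ := by simpa using hw
      have hn : (q₁ ++ w :: (q₂ ++ [u] ++ v :: s)).Nodup := by simpa using hnd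
      exact append_cons_cancel hn hE
    -- From the start to `w`, then to `u` and backwards to `y`, then on from `v`.
    refine ⟨y, r ++ v :: s, by rw [← this.2, hyr]; rfl, fun hvy => ?_⟩
    refine key (q₁ ++ [w] ++ (q₂ ++ [u]).reverse ++ v :: s) ?_ ?_
    · have := (List.reverse_perm (q₂ ++ [u])).append_left (q₁ ++ [w])
      simpa using this.append_right (v :: s)
    · have c1 : (q₁ ++ [w]).IsChain G.Adj := h1.prefix ⟨q₂ ++ [u], by simp⟩
      have c2 : (q₂ ++ [u]).IsChain G.Adj := h1.suffix ⟨q₁ ++ [w], by simp⟩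
      rw [List.append_assoc]
      refine c1.append ((isChain_reverse_adj.2 c2).append h2 ?_) ?_
      · rw [hyr]; simpa using hvy.symm
      · simpa using huw.symm
  · obtain ⟨q₁, q₂, rfl⟩ := List.append_of_mem hmem
    have : p ++ u :: v :: q₁ = p₁ ∧ q₂ = p₂ := by
      have hE : (p ++ u :: v :: q₁) ++ w :: q₂ = p₁ ++ w :: p₂ := by simpa using hw
      have hn : ((p ++ u :: v :: q₁) ++ w :: q₂).Nodup := by simpa using hnd
      exact append_cons_cancel hn hE
    rw [← this.2]
    -- From the start to `u`, then to `w` and backwards to `v`, then on from `y`, if any vertices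
    -- are left.
    have c1 : (v :: q₁ ++ [w]).IsChain G.Adj := h2.prefix ⟨q₂, by simp⟩
    have c : (p ++ [u] ++ (v :: q₁ ++ [w]).reverse).IsChain G.Adj :=
      h1.append (isChain_reverse_adj.2 c1) (by simpa using huw)
    have hp : (p ++ [u] ++ (v :: q₁ ++ [w]).reverse ++ q₂).Perm (p ++ u :: v :: (q₁ ++ w :: q₂)) := by
      have := (List.reverse_perm (v :: q₁ ++ [w])).append_left (p ++ [u])
      simpa using this.append_right q₂
    rcases q₂ with _ | ⟨y, r⟩
    · exact absurd c (key _ (by simpa using hp))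
    · refine ⟨y, r, rfl, fun hvy => key _ hp ?_⟩
      rw [List.append_assoc]
      refine h1.append ((isChain_reverse_adj.2 c1).append (h2.suffix ⟨v :: q₁ ++ [w], by simp⟩) ?_) ?_
      · rw [List.cons_append, List.reverse_cons]
        simpa only [List.getLast?_concat, List.head?_cons, Option.mem_def, Option.some.injEq,
          forall_eq'] using hvy
      · simpa using huw

theorem degree_add_degree_le_of_split [Fintype V] [DecidableRel G.Adj] {p s : List V}
    (hG : ¬ G.Traceable) (hnd : (p ++ u :: v :: s).Nodup)
    (hall : ∀ w, w ∈ p ++ u :: v :: s) (h1 : (p ++ [u]).IsChain G.Adj) (h2 : (v :: s).IsChain G.Adj) :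
    G.degree u + G.degree v + 2 ≤ Fintype.card V := by
  classical
  set L := p ++ u :: v :: s with hL
  have hlen : L.length = Fintype.card V := by
    rw [← List.toFinset_card_of_nodup hnd, ← card_univ]
    congr 1; ext w; simpa using hall w
  have hidx : ∀ p₁ y p₂, L = p₁ ++ y :: p₂ → L.idxOf y = p₁.length := by
    intro p₁ y p₂ h
    rw [h] at hnd ⊢
    rw [List.idxOf_append_of_notMem (by grind), List.idxOf_cons_self, add_zero]
  have hinj : ∀ x y, L.idxOf x = L.idxOf y → x = y := fun x y h => (List.idxOf_inj (hall x)).1 h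
  have hsucc : ∀ w, G.Adj u w → ∃ y, L.idxOf y = L.idxOf w + 1 ∧ ¬ G.Adj v y := by
    intro w huw
    obtain ⟨p₁, p₂, hw⟩ := List.append_of_mem (hall w)
    obtain ⟨y, r, rfl, hy⟩ := exists_next_not_adj hG hnd hall h1 h2 hw huw
    refine ⟨y, ?_, hy⟩
    rw [hidx _ _ _ hw, hidx (p₁ ++ [w]) y r (by simpa using hw)]
    simp
  have hhead : ∀ x, L.idxOf x = 0 → ¬ G.Adj v x := by
    intro x hx hvx
    obtain ⟨y, r, hyr⟩ : ∃ y r, p ++ [u] = y :: r := List.exists_cons_of_ne_nil (by simp)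
    have hLy : L = [] ++ y :: (r ++ v :: s) := by
      have : L = (p ++ [u]) ++ v :: s := by simp [L]
      rw [this, hyr]; rfl
    obtain rfl : x = y := hinj _ _ (by rw [hx, hidx _ _ _ hLy]; rfl)
    refine hG ⟨(p ++ [u]).reverse ++ v :: s, .of_perm hnd hall ?_ ?_⟩
    · have := (List.reverse_perm (p ++ [u])).append_right (v :: s)
      simpa [L] using this
    · refine (isChain_reverse_adj.2 h1).append h2 ?_
      rw [hyr]; simpa using hvx.symm
  have hu : L.idxOf u = p.length := hidx p u _ rfl
  have hv : L.idxOf v = p.length + 1 := by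
    rw [hidx (p ++ [u]) v s (by simp [L])]; simp
  have hlt : ∀ x, L.idxOf x < L.length := fun x => List.idxOf_lt_length_iff.2 (hall x)
  -- The successors of the neighbours of `u`, the neighbours of `v`, the first vertex and `v` itself
  -- occupy disjoint sets of positions.
  set S₁ := (G.neighborFinset u).image fun w => L.idxOf w + 1 with hS₁
  set S₂ := (G.neighborFinset v).image L.idxOf with hS₂
  have e₁ : #S₁ = G.degree u := card_image_of_injective _ fun x y h => hinj x y (by simpa using h)
  have e₂ : #S₂ = G.degree v := card_image_of_injective _ fun x y h => hinj x y h
  have d₁ : Disjoint S₁ S₂ := by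
    rw [Finset.disjoint_left]
    simp only [hS₁, hS₂, mem_image, mem_neighborFinset, not_exists, not_and]
    rintro _ ⟨w, hw, rfl⟩ x hx hxw
    obtain ⟨y, hy, hvy⟩ := hsucc w hw
    exact hvy (hinj x y (hxw.trans hy.symm) ▸ hx)
  have d₂ : Disjoint (S₁ ∪ S₂) {0, p.length + 1} := by
    rw [Finset.disjoint_left]
    simp only [hS₁, hS₂, mem_union, mem_image, mem_neighborFinset, mem_insert, mem_singleton]
    rintro _ (⟨w, hw, rfl⟩ | ⟨x, hx, rfl⟩) (h | h)
    · omega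
    · exact hw.ne (hinj u w (by omega))
    · exact hhead x h hx
    · exact hx.ne (hinj v x (by omega))
  have hsub : (S₁ ∪ S₂) ∪ {0, p.length + 1} ⊆ range L.length := by
    intro j
    simp only [hS₁, hS₂, mem_union, mem_image, mem_neighborFinset, mem_insert, mem_singleton, mem_range]
    rintro ((⟨w, hw, rfl⟩ | ⟨x, hx, rfl⟩) | (rfl | rfl))
    · obtain ⟨y, hy, -⟩ := hsucc w hw
      exact hy ▸ hlt y
    · exact hlt x
    · exact (Nat.zero_le _).trans_lt (hlt u)
    · exact hv ▸ hlt v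
  have := card_le_card hsub
  rw [card_union_of_disjoint d₂, card_union_of_disjoint d₁, e₁, e₂, card_range, hlen,
    card_pair (by omega)] at this
  exact this

/-- In a maximal graph without Hamiltonian path, nonadjacent vertices have degree sum at most
`n - 2`. -/
theorem degree_add_degree_le [Fintype V] [DecidableRel G.Adj]
    (hG : Maximal (fun H : SimpleGraph V => ¬ H.Traceable) G)
    (huv : u ≠ v) (hadj : ¬ G.Adj u v) : G.degree u + G.degree v + 2 ≤ Fintype.card V := by
  have : (G ⊔ edge u v).Traceable := by
    by_contra h
    have := hG.2 h le_sup_left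
    exact hadj (this (by simp [edge_adj, huv]))
  obtain ⟨l, hnd, hall, hc⟩ := this
  obtain ⟨a, b, p, s, hab, rfl, h1, h2⟩ := exists_split hnd hc fun h => hG.1 ⟨l, hnd, hall, h⟩
  have := degree_add_degree_le_of_split hG.1 hnd hall h1 h2
  rcases hab with ⟨rfl, rfl⟩ | ⟨rfl, rfl⟩ <;> omega

theorem traceable_top [Fintype V] : (⊤ : SimpleGraph V).Traceable := by
  classical
  refine ⟨univ.toList, nodup_toList _, by simp, ?_⟩
  exact (nodup_toList univ).isChain

end

/-! ### The spanning tree of a Hamiltonian path -/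

theorem exists_tree_of_isHamPath {V : Type*} [Fintype V] {G : SimpleGraph V} {l : List V}
    (h : G.IsHamPath l) (h5 : 5 ≤ Fintype.card V) :
    ∃ T : SimpleGraph V, T ≤ G ∧ T.IsTree ∧ 4 ≤ T.leafDistance := by
  classical
  obtain ⟨h1, h2, h3⟩ := h
  have hlen : l.length = Fintype.card V := by
    rw [← List.toFinset_card_of_nodup h1, ← card_univ]
    congr 1; ext w; simpa using h2 w
  obtain ⟨n, hn⟩ : ∃ n, l.length = n + 1 := ⟨l.length - 1, by omega⟩
  let e : Fin (n+1) ≃ V := Equiv.ofBijective (fun i => l[i]) <| by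
    refine (Fintype.bijective_iff_injective_and_card _).2 ⟨fun i j hij => ?_, by simp; omega⟩
    exact Fin.ext ((h1.getElem_inj_iff).1 hij)
  -- `e` lists the vertices along the path, and `T` is the path.
  let T := (pathGraph (n+1)).map e
  let i : pathGraph (n+1) ≃g T := Iso.map e _
  have hT : ∀ a b, T.Adj (e a) (e b) ↔ a.val + 1 = b.val ∨ b.val + 1 = a.val := fun a b => by
    rw [← pathGraph_adj]; exact i.map_adj_iff
  have hstep : ∀ a b : Fin (n+1), a.val + 1 = b.val → G.Adj (e a) (e b) := by
    rintro ⟨a, ha⟩ ⟨b, hb⟩ rfl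
    exact List.isChain_iff_getElem.1 h3 a (by simp only at hb; omega)
  refine ⟨T, ?_, ?_, ?_⟩
  · intro x y hxy
    obtain ⟨a, rfl⟩ := e.surjective x
    obtain ⟨b, rfl⟩ := e.surjective y
    rcases (hT a b).1 hxy with h | h
    · exact hstep _ _ h
    · exact (hstep _ _ h).symm
  · rw [← i.isTree_iff, isTree_iff_connected_and_card]
    refine ⟨pathGraph_connected n, le_antisymm ?_ ?_⟩
    · have hsub : (pathGraph (n+1)).edgeSet ⊆ Set.range fun j : Fin n => s(j.castSucc, j.succ) := by
        rintro x
        induction x with | _ a b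
        rw [mem_edgeSet, pathGraph_adj]
        rintro (h | h)
        · exact ⟨⟨a, by omega⟩, by rw [Sym2.eq_iff]; left; constructor <;> ext <;> simp [h]⟩
        · exact ⟨⟨b, by omega⟩, by rw [Sym2.eq_iff]; right; constructor <;> ext <;> simp [h]⟩
      have h4 := Set.ncard_le_ncard hsub (Set.toFinite _)
      have h5 := Set.ncard_image_le (f := fun j : Fin n => s(j.castSucc, j.succ)) (Set.toFinite Set.univ)
      rw [Set.image_univ, Set.ncard_univ, Nat.card_fin] at h5
      rw [Nat.card_coe_set_eq, Nat.card_fin]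
      omega
    · simpa using (pathGraph_connected n).card_vert_le_card_edgeSet_add_one
  · have hleaf : ∀ a, T.IsLeaf (e a) → a.val = 0 ∨ a.val = n := by
      intro a ha
      by_contra! hcon
      obtain ⟨x, hx⟩ := Set.ncard_eq_one.1 ha
      have m1 : e ⟨a - 1, by omega⟩ ∈ T.neighborSet (e a) := (hT _ _).2 (by simp; omega)
      have m2 : e ⟨a + 1, by omega⟩ ∈ T.neighborSet (e a) := (hT _ _).2 (by simp)
      rw [hx, Set.mem_singleton_iff] at m1 m2
      have := congrArg Fin.val (e.injective (m1.trans m2.symm))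
      simp at this
    -- Positions on the path change by one along an edge.
    have hd : ∀ x y (w : T.Walk x y), (e.symm y).val ≤ (e.symm x).val + w.length ∧
        (e.symm x).val ≤ (e.symm y).val + w.length := by
      intro x y w
      induction w with
      | nil => simp
      | @cons x z y hxz w ih =>
        have := (hT (e.symm x) (e.symm z)).1 (by simpa using hxz)
        rw [Walk.length_cons]
        omega
    refine le_iInf fun x => le_iInf fun y => le_iInf fun hx => le_iInf fun hy => le_iInf fun hxy => ?_
    refine le_iInf fun w => ?_
    have hx' := hleaf (e.symm x) (by simpa using hx)
    have hy' := hleaf (e.symm y) (by simpa using hy)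
    have hne : (e.symm x).val ≠ (e.symm y).val := fun h => hxy (e.symm.injective (Fin.ext h))
    have := hd x y w
    have : 4 ≤ w.length := by omega
    exact_mod_cast this

/-! ### The Rayleigh quotient of the test vector -/

/-- The Rayleigh quotient estimate. Here `k = #A`, `t - q` is the number of vertices of weight `a`,
and `X`, `2 E`, `Y` are the numbers of ordered nonadjacent pairs inside `A`, between `A` and the
vertices of weight `1`, and among the latter. Since `Y` has two lower bounds, a convex combination
with coefficient `θ` is used. -/
theorem rayleigh_inequality (n t k q m c a X E Y θ : ℝ) (ht : 1 ≤ t) (hn : 7*t+2 ≤ n)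
  (hk : t+1 ≤ k) (hk2 : 2*k ≤ n)
  (hq : 0 ≤ q) (hm : n ≤ m) (hc1 : 1 ≤ c) (ha1 : a ≤ 1)
  (hc : c*(m+1) = m + (n-2*t)) (ha : a*m = m - t*c) (hS : t*a + (n-2*t)+t*c = a*m)
  (hX : X ≤ k*(k-1)) (hXE : k*(n-k) ≤ X+E) (hY : 0 ≤ Y)
  (hθ0 : 0 ≤ θ) (hθ1 : θ ≤ 1) (hθ2 : θ ≤ 2*c - c^2) (hθ3 : q*(t*(c*(1-a))) ≤ q*(t*θ))
  (hEY : θ * ((t+1)*(n-k-(t-q))) ≤ θ*(E+Y)) :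
  m*((t-q)*a^2 + (n-k-(t-q)) + k*c^2) < ((t-q)*a + (n-k-(t-q)) + k*c)^2 + c^2*X+2*c*E+Y := by
  obtain ⟨p, rfl⟩ : ∃ p, k = t + p := ⟨k-t, by ring⟩
  obtain ⟨N, rfl⟩ : ∃ N, n = N + 2*t := ⟨n-2*t, by ring⟩
  -- With `p = k - t` and `N = n - 2 t`, the gain is at least `p * h`, where `h` is affine in `p` with
  -- values `h0` at `p = 0` and `h1` at `p = N / 2`.
  set h0 := c*(N-2*t+1)+N-θ*(N-t) with h0d
  have hh0 : 0 < h0 := by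
    have := mul_le_mul_of_nonneg_right hθ1 (by linarith : 0 ≤ N-t)
    have := mul_pos (by linarith : 0 < c) (by linarith : 0 < N-2*t+1)
    linarith
  set h1 := c*(N-2*t+1)+N+θ*t + N/2*(2*c^2-6*c+1) with h1d
  have hh1 : 0 < h1 := by
    have : 0 ≤ θ*t := by positivity
    -- `N ≥ 5 t` gives `h1 ≥ N * (c ^ 2 - 12 / 5 * c + 3 / 2)`, which has no real root.
    have := mul_nonneg (by linarith : 0 ≤ N) (sq_nonneg (c-6/5))
    have := mul_nonneg (by linarith : 0 ≤ c) (by linarith : 0 ≤ N-5*t)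
    nlinarith
  have hlin : N*(c*(N-2*t+1)+N-θ*(N-t-2*p)+p*(2*c^2-6*c+1)) = (N-2*p)*h0+2*p*h1 := by
    rw [h0d, h1d]; ring
  set h := c*(N-2*t+1)+N-θ*(N-t-2*p)+p*(2*c^2-6*c+1) with hd
  have hhp : 0 < h := by
    have : 0 < N*h := by
      rw [hlin]
      have := mul_pos (by linarith : 0 < 2*p) hh1
      have := mul_nonneg (by linarith : 0 ≤ N-2*p) hh0.le
      linarith
    exact pos_of_mul_pos_right this (by linarith)
  have hlow : (c^2-2*c+θ)*((t+p)*(t+p-1)) + (2*c-θ)*((t+p)*(N+2*t-(t+p)))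
      + θ*((t+1)*(N+2*t-(t+p)-(t-q))) ≤ c^2*X+2*c*E+Y := by
    have hθc : 0 ≤ 2*c-θ := by linarith
    have e1 := mul_nonneg (by linarith : 0 ≤ 2*c - c^2-θ) (sub_nonneg.2 hX)
    have e2 := mul_nonneg hθc (sub_nonneg.2 hXE)
    have e3 := mul_nonneg (by linarith : 0 ≤ 1-θ) hY
    linarith
  -- By the eigenvalue equations `hc`, `ha`, `hS` the terms of the extremal graph itself cancel.
  have key : ((t-q)*a + (N+2*t-(t+p)-(t-q)) + (t+p)*c)^2
      + ((c^2-2*c+θ)*((t+p)*(t+p-1)) + (2*c-θ)*((t+p)*(N+2*t-(t+p)))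
        + θ*((t+1)*(N+2*t-(t+p)-(t-q)))) - m*((t-q)*a^2 + (N+2*t-(t+p)-(t-q)) + (t+p)*c^2)
     = p*h + 2*c*t + 2*p*q*(c-1)*(1-a)+q^2*(1-a)^2 + q*(θ*(t+1)-t*(c*(1-a))) + θ*(N-t-2*p) := by
    rw [hd]
    linear_combination (t*a+N+t*c + 2*(p*(c-1)+q*(1-a)))*hS +
      (N+t*c+q*(1-a)+2*p*(c-1))*ha - (t*c+p*(c-1))*hc
  have f1 : 0 < p*h := mul_pos (by linarith) hhp
  have f2 : 0 ≤ 2*p*q*(c-1)*(1-a) :=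
    mul_nonneg (mul_nonneg (mul_nonneg (by linarith) hq) (by linarith)) (by linarith)
  have f3 : 0 ≤ q^2*(1-a)^2 := by positivity
  have f4 : 0 ≤ q*θ := mul_nonneg hq hθ0
  have f5 : 0 ≤ 2*c*t+ θ*(N-t-2*p) := by
    have := mul_nonneg hθ0 (by linarith : 0 ≤ N-2*p)
    have := mul_le_mul_of_nonneg_right hθ1 (by linarith : 0 ≤ t)
    have := mul_le_mul_of_nonneg_right hc1 (by linarith : 0 ≤ t)
    linarith
  linarith

variable {V : Type*} [Fintype V] {G : SimpleGraph V}

/-- The test vector with value `c` on `A`, `a` on `F` and `1` elsewhere shows that the distance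
spectral radius of `G` exceeds `m - 1`, the bound for the one of the extremal graph. -/
theorem lt_distSpectralRadius [Nonempty V] [DecidableEq V] {H : SimpleGraph V} [DecidableRel H.Adj]
    (hG : G.Connected) (hGH : G ≤ H) {t : ℕ} {A F : Finset V} (ht : 1 ≤ t)
    (hn : 7 * t + 2 ≤ Fintype.card V) (hAF : Disjoint A F) (hk : t + 1 ≤ #A) (hk2 : 2 * #A ≤ Fintype.card V)
    (hA : ∀ a ∈ A, H.degree a + 1 ≤ #A)
    (hF : ∀ v ∈ F, ∀ w, w ≠ v → H.Adj v w) (hFt : #F ≤ t)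
    (hR : #F < t → ∀ v ∉ F, H.degree v + t + 2 ≤ Fintype.card V)
    {m a c : ℝ} (hm : Fintype.card V ≤ m) (hc1 : 1 ≤ c) (ha0 : 0 ≤ a) (ha1 : a ≤ 1)
    (hca : c ≤ 1 + a) (hca' : c*(1-a) ≤ 1)
    (hc : c*(m+1) = m + (Fintype.card V-2*t)) (ha : a*m = m - t*c)
    (hS : t*a + (Fintype.card V-2*t)+t*c = a*m) :
    m - 1 < G.distSpectralRadius := by
  set n := Fintype.card V with hnV
  -- Indicator functions of `A`, of `F` and of the remaining vertices.
  let α : V → ℝ := fun v => if v ∈ A then 1 else 0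
  let φ : V → ℝ := fun v => if v ∈ F then 1 else 0
  let ρ : V → ℝ := fun v => 1 - α v - φ v
  let x : V → ℝ := fun v => c * α v + a * φ v + ρ v
  have hcases : ∀ v, (v ∈ A ∧ α v = 1 ∧ φ v = 0 ∧ ρ v = 0) ∨ (v ∈ F ∧ α v = 0 ∧ φ v = 1 ∧ ρ v = 0) ∨
      (v ∉ A ∧ v ∉ F ∧ α v = 0 ∧ φ v = 0 ∧ ρ v = 1) := by
    intro v
    have : v ∈ A → v ∉ F := fun h => Finset.disjoint_left.1 hAF h
    by_cases h1 : v ∈ A <;> by_cases h2 : v ∈ F <;> simp_all [α, φ, ρ]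
  have hα0 : ∀ v, 0 ≤ α v := fun v => by rcases hcases v with h | h | h <;> simp [h]
  have hρ0 : ∀ v, 0 ≤ ρ v := fun v => by rcases hcases v with h | h | h <;> simp [h]
  have hx0 : ∀ v, 0 ≤ x v := fun v => by rcases hcases v with h | h | h <;> simp [x, h] <;> linarith
  have sα : ∑ v, α v = #A := by simp [α]
  have sφ : ∑ v, φ v = #F := by simp [φ]
  have sρ : ∑ v, ρ v = n - #A - #F := by
    simp only [ρ, sum_sub_distrib, sα, sφ]; simp [hnV]
  have sx : ∑ v, x v = #F * a + (n - #A - #F) + #A * c := by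
    simp only [x, sum_add_distrib, ← mul_sum, sα, sφ, sρ]; ring
  have sx2 : ∑ v, x v ^ 2 = #F * a ^ 2 + (n - #A - #F) + #A * c ^ 2 := by
    have : ∀ v, x v ^ 2 = c ^ 2 * α v + a ^ 2 * φ v + ρ v := fun v => by
      rcases hcases v with h | h | h <;> simp [x, h]
    simp only [this, sum_add_distrib, ← mul_sum, sα, sφ, sρ]; ring
  -- `e` is the indicator of nonadjacent pairs of distinct vertices of `H`; none of them meets `F`.
  set e : V → V → ℝ := fun u v => Hᶜ.adjMatrix ℝ u v with he
  have he0 : ∀ u v, 0 ≤ e u v := fun u v => by simp only [he, adjMatrix_apply]; split_ifs <;> simp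
  have he1 : ∀ u v, e u v ≤ 1 - if u = v then 1 else 0 := fun u v => by
    simp only [he, adjMatrix_apply, compl_adj]
    by_cases h1 : u = v <;> simp [h1]
    split_ifs <;> simp
  have hesymm : ∀ u v, e u v = e v u := fun u v => by simp only [he, adjMatrix_apply, adj_comm]
  have heF : ∀ u v, φ v * e u v = 0 := fun u v => by
    rcases hcases v with h | h | h
    · simp [h]
    · have := hF v h.1 u
      simp only [he, adjMatrix_apply, compl_adj]
      rw [if_neg (fun h' => h'.2 (this h'.1).symm), mul_zero]
    · simp [h]
  have hdeg : ∀ u, ∑ v, (α v + ρ v) * e u v = n - 1 - H.degree u := fun u => by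
    have h1 : ∀ v, (α v + ρ v) * e u v = e u v := fun v => by
      have := heF u v
      simp only [ρ]; linarith
    have h2 : ∑ v, e u v = Hᶜ.degree u := by
      simp [he, adjMatrix_apply, ← card_neighborFinset_eq_degree, neighborFinset_eq_filter]
    simp_rw [h1, h2, degree_compl]
    have := H.degree_lt_card_verts u
    rw [Nat.cast_sub (by omega), Nat.cast_sub (by omega)]; simp [hnV]
  set X := ∑ u, ∑ v, α u * α v * e u v with hX
  set E := ∑ u, ∑ v, α u * ρ v * e u v with hE
  set Y := ∑ u, ∑ v, ρ u * ρ v * e u v with hY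
  have hE' : ∑ u, ∑ v, ρ u * α v * e u v = E := by
    rw [hE, sum_comm]
    refine sum_congr rfl fun u _ => sum_congr rfl fun v _ => ?_
    rw [hesymm]; ring
  have hquad : ∑ u, ∑ v, x u * x v * e u v = c ^ 2 * X + 2 * c * E + Y := by
    have h1 : ∀ u v, x u * x v * e u v = c ^ 2 * (α u * α v * e u v) + c * (α u * ρ v * e u v)
        + c * (ρ u * α v * e u v) + ρ u * ρ v * e u v := fun u v => by
      have f1 := heF u v
      have f2 := heF v u
      rw [hesymm] at f2
      simp only [x]
      linear_combination (c * α u + a * φ u + ρ u) * a * f1 + a * (c * α v + ρ v) * f2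
    simp_rw [h1, sum_add_distrib, ← mul_sum]
    rw [hE']; ring
  have hXle : X ≤ #A * (#A - 1) := by
    have : X ≤ ∑ u, ∑ v, α u * α v * (1 - if u = v then 1 else 0) :=
      sum_le_sum fun u _ => sum_le_sum fun v _ =>
        mul_le_mul_of_nonneg_left (he1 u v) (mul_nonneg (hα0 u) (hα0 v))
    refine this.trans_eq ?_
    have h2 : ∀ u, α u * α u = α u := fun u => by rcases hcases u with h | h | h <;> simp [h]
    simp_rw [mul_sub, sum_sub_distrib, mul_ite, mul_one, mul_zero, sum_ite_eq, if_pos (mem_univ _), h2,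
      ← mul_sum, ← sum_mul, sα]
  have hXE : (#A : ℝ) * (n - #A) ≤ X + E := by
    have h1 : X + E = ∑ u, α u * (n - 1 - H.degree u) := by
      simp_rw [hX, hE, ← sum_add_distrib, ← hdeg, mul_sum]
      exact sum_congr rfl fun u _ => sum_congr rfl fun v _ => by ring
    rw [h1, ← sα, sum_mul]
    refine sum_le_sum fun u _ => ?_
    rcases hcases u with h | h | h
    · rw [sα, h.2.1]
      have : (H.degree u : ℝ) + 1 ≤ #A := by exact_mod_cast hA u h.1
      linarith
    · simp [h]
    · simp [h]
  have hEY : #F < t → ((t : ℝ) + 1) * (n - #A - #F) ≤ E + Y := fun hlt => by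
    have h1 : E + Y = ∑ u, ρ u * (n - 1 - H.degree u) := by
      rw [← hE', hY]
      simp_rw [← sum_add_distrib, ← hdeg, mul_sum]
      exact sum_congr rfl fun u _ => sum_congr rfl fun v _ => by ring
    rw [h1, ← sρ, mul_comm, sum_mul]
    refine sum_le_sum fun u _ => ?_
    rcases hcases u with h | h | h
    · simp [h]
    · simp [h]
    · have : (H.degree u : ℝ) + t + 2 ≤ n := by exact_mod_cast hR hlt u h.2.1
      refine mul_le_mul_of_nonneg_left ?_ (hρ0 u)
      linarith
  have hY0 : 0 ≤ Y := sum_nonneg fun u _ => sum_nonneg fun v _ =>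
    mul_nonneg (mul_nonneg (hρ0 u) (hρ0 v)) (he0 u v)
  have hlow := (hG.le_sum_mul_dist hGH hx0).trans (sum_mul_dist_le G x)
  rw [hquad] at hlow
  have htR : (1 : ℝ) ≤ t := by exact_mod_cast ht
  have hfR : (#F : ℝ) ≤ t := by exact_mod_cast hFt
  have hmain : m * ∑ v, x v ^ 2 < (∑ v, x v) ^ 2 + c ^ 2 * X + 2 * c * E + Y := by
    rw [sx, sx2]
    have key := fun θ => rayleigh_inequality n t #A (t - #F) m c a X E Y θ htR (by exact_mod_cast hn)
      (by exact_mod_cast hk) (by exact_mod_cast hk2) (by linarith) hm hc1 ha1 hc ha hS hXle hXE hY0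
    simp only [sub_sub_cancel] at key
    -- If `#F = t`, the bound on the degrees outside `A ∪ F` is not available, and `θ = 0` suffices.
    rcases hFt.lt_or_eq with hlt | heq
    · refine key (c * (1 - a)) (mul_nonneg (by linarith) (by linarith)) hca' ?_ le_rfl ?_
      · nlinarith
      · exact mul_le_mul_of_nonneg_left (hEY hlt) (mul_nonneg (by linarith) (by linarith))
    · refine key 0 le_rfl zero_le_one ?_ ?_ ?_
      · nlinarith
      · simp [heq]
      · simp
  have hpos : 0 ≤ ∑ v, x v ^ 2 := sum_nonneg fun v _ => sq_nonneg _
  nlinarith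

/-! ### Graphs without Hamiltonian path -/

/-- A maximal graph without Hamiltonian path has a set `A` of vertices of degree less than `#A`. With
`u`, `v` nonadjacent of largest degree sum and `d(u) ≤ d(v)`, all nonneighbours of `v` have degree at
most `d(u)`, and there are at least `d(u) + 1` of them. -/
theorem exists_low_degree_set [DecidableRel G.Adj]
    (hG : Maximal (fun H : SimpleGraph V => ¬ H.Traceable) G) :
    ∃ A : Finset V, (∀ a ∈ A, G.degree a + 1 ≤ #A ∧ ∃ v, v ≠ a ∧ ¬ G.Adj v a) ∧
      G.minDegree + 1 ≤ #A ∧ 2 * #A ≤ Fintype.card V := by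
  classical
  obtain ⟨x, y, hxy, hxy'⟩ : ∃ x y, x ≠ y ∧ ¬ G.Adj x y := by
    by_contra! h
    refine hG.1 ?_
    obtain rfl : G = ⊤ := by ext x y; rw [top_adj]; exact ⟨fun e => e.ne, h x y⟩
    exact traceable_top
  let P := univ.filter fun p : V × V => p.1 ≠ p.2 ∧ ¬ G.Adj p.1 p.2
  obtain ⟨⟨u, v⟩, huv, hmax⟩ := P.exists_max_image (fun p => G.degree p.1 + G.degree p.2)
    ⟨(x, y), by simp [P, hxy, hxy']⟩
  wlog hle : G.degree u ≤ G.degree v generalizing u v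
  · refine this v u ?_ ?_ (le_of_not_ge hle)
    · simpa [P, G.adj_comm, eq_comm] using huv
    · intro p hp
      have := hmax p hp
      simp only at this ⊢
      omega
  have huv' : u ≠ v ∧ ¬ G.Adj u v := by simpa [P] using huv
  have hsum := degree_add_degree_le hG huv'.1 huv'.2
  have hcard : G.degree u + 1 ≤ #(Gᶜ.neighborFinset v) := by
    rw [card_neighborFinset_eq_degree, degree_compl]; omega
  obtain ⟨A, hA, hAc⟩ := exists_subset_card_eq hcard
  refine ⟨A, fun a ha => ?_, ?_, by omega⟩
  · have := hA ha
    rw [mem_neighborFinset, compl_adj] at this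
    refine ⟨?_, v, this⟩
    have := hmax (a, v) (by simpa [P, G.adj_comm, eq_comm] using this)
    simp only at this
    omega
  · have := G.minDegree_le_degree u
    omega

theorem traceable_of_distSpectralRadius_le {t : ℕ} [DecidableRel G.Adj] (hG : G.Connected) (ht : 1 ≤ t)
    (hn : 7 * t + 2 ≤ Fintype.card V) (hδ : t ≤ G.minDegree)
    (hμ : G.distSpectralRadius ≤ (extremalGraph (Fintype.card V) t).distSpectralRadius) : G.Traceable := by
  classical
  by_contra hnot
  have := hG.nonempty
  obtain ⟨H, hGH, hmax⟩ := Finite.exists_le_maximal (p := fun H : SimpleGraph V => ¬ H.Traceable) hnot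
  obtain ⟨A, hA, hAδ, hA2⟩ := exists_low_degree_set hmax
  have hδH : t ≤ H.minDegree := by
    refine H.le_minDegree_of_forall_le_degree t fun v => ?_
    exact (hδ.trans (G.minDegree_le_degree v)).trans (degree_le_of_le hGH)
  -- `U` is the set of dominating vertices of `H`, and `F` consists of at most `t` of them.
  let U : Finset V := univ.filter fun v => ∀ w, w ≠ v → H.Adj v w
  obtain ⟨F, hFU, hF⟩ := exists_subset_card_eq (min_le_left #U t)
  obtain ⟨m, a, c, hm, hc1, ha0, ha1, hca, hca', h1, h2, h3⟩ :=
    exists_weights (Fintype.card V) t (by exact_mod_cast ht) (by exact_mod_cast hn)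
  have hup := distSpectralRadius_extremalGraph_le (n := Fintype.card V) ht (by omega) ha0 (by linarith) h1 h2 h3
  have hFadj : ∀ v ∈ F, ∀ w, w ≠ v → H.Adj v w := fun v hv => (mem_filter.1 (hFU hv)).2
  have := lt_distSpectralRadius hG hGH (A := A) (F := F) ht hn ?_ (by omega) hA2 (fun v hv => (hA v hv).1)
    hFadj (by omega) ?_ hm hc1 ha0.le ha1 hca hca' h1 h2 h3
  · linarith
  · rw [Finset.disjoint_left]
    intro v hvA hvF
    obtain ⟨w, hw, hvw⟩ := (hA v hvA).2
    exact hvw (hFadj v hvF w hw).symm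
  · intro hlt v hv
    have hFU' : F = U := eq_of_subset_of_card_le hFU (by omega)
    rw [hFU'] at hv
    simp only [U, mem_filter, mem_univ, true_and, not_forall] at hv
    obtain ⟨w, hw, hvw⟩ := hv
    have := degree_add_degree_le hmax hw.symm hvw
    have := H.minDegree_le_degree w
    omega
end SimpleGraph

theorem theorem1p4 {V : Type*} [Fintype V] (G : SimpleGraph V) [DecidableRel G.Adj]
    (n t : ℕ) (hG : G.Connected) (hn : Fintype.card V = n) (ht : 1 ≤ t)
    (hnt : 7 * t + 2 ≤ n) (hδ : t ≤ G.minDegree)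
    (hμ : G.distSpectralRadius ≤ (SimpleGraph.extremalGraph n t).distSpectralRadius) :
    ∃ T : SimpleGraph V, T ≤ G ∧ T.IsTree ∧ 4 ≤ T.leafDistance := by
  subst hn
  obtain ⟨l, hl⟩ := SimpleGraph.traceable_of_distSpectralRadius_le hG ht hnt hδ hμ
  exact SimpleGraph.exists_tree_of_isHamPath hl (by omega)
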